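/- **Setting.** Let $\alpha$ be an action of $\mathbb Z^r$ on $\mathbb T^d=\mathbb R^d/\mathbb Z^d$ by toral automorphisms $\alpha^{\mathbf n}\in GL(d,\mathbb Z)$. A toral automorphism is *irreducible* if it has no proper invariant subtorus of positive dimension, and *totally irreducible* if all its nonzero powers are irreducible. Assume that $\alpha^{\mathbf n}$ is irreducible for some $\mathbf n$, and let $\alpha$ be realized as follows: $K$ is a number field of degree $d$ with $r_1$ real and $r_2$ pairs of complex embeddings, $I$ is the set of its $r_1+r_2$ infinite places (one embedding $\sigma_i$ chosen for each), $\sigma=(\sigma_i)_{i\in I}:K\to\mathbb R^{r_1}\oplus\mathbb C^{r_2}=\bigoplus_{i\in I}V_i$ with $V_i=\mathbb R$ or $\mathbb C$, $\mathbf n\mapsto\zeta^{\mathbf n}$ is an injective homomorphism from $\mathbb Z^r$ to the unit group of the ring of integers of $K$, $\Gamma\subset\sigma(K)$ is a cocompact lattice in $\mathbb R^{r_1}\oplus\mathbb C^{r_2}$ preserved by the coordinatewise multiplication by every $\sigma(\zeta^{\mathbf n})$, and $\psi:\mathbb T^d\to X:=(\mathbb R^{r_1}\oplus\mathbb C^{r_2})/\Gamma$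 is a continuous group isomorphism with $\psi(\alpha^{\mathbf n}.x)=\zeta^{\mathbf n}.\psi(x)$, where $\zeta^{\mathbf n}.$ denotes the action on $X$ induced by multiplication by $\sigma(\zeta^{\mathbf n})$. For $x\in X$ and a vector $v$, $x+v$ means $x+\pi(v)$, where $\pi:\mathbb R^{r_1}\oplus\mathbb C^{r_2}\to X$ is the projection. For $i\in I$ let $\lambda_i(\mathbf n)=\log|\sigma_i(\zeta^{\mathbf n})|$, extended linearly to $\mathbb R^r$, and $\beta_i(\mathbf n)=\arg\sigma_i(\zeta^{\mathbf n})\in\mathbb R/2\pi\mathbb Z$, with $\|\cdot\|$ the distance to $0$ in $\mathbb R/2\pi\mathbb Z$. Let $S\subset I$, let $L_S\subset(\mathbb R^r)^*$ be the span of $\{\lambda_i:i\in S\}$, $\langle S\rangle=\{i\in I:\lambda_i\in L_S\}$, $V_{\langle S\rangle}=\bigoplus_{i\in\langle S\rangle}V_i$ and $P_S=\{\eta\in\mathbb R^r:\lambda_i(\eta)=0\ \forall i\in S\}$. Assume 1. $\dim L_S\le r-2$; 2. for every $\epsilon>0$ there is $\mathbf n\in\mathbb Z^r$ such that $\alpha^{\mathbf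 n}$ is totally irreducible and $|\lambda_i(\mathbf n)|<\epsilon$ for all $i\in S$. For $\lambda\in(P_S)^*$ let $I_{[\lambda]}=\{i\in I:\lambda_i|_{P_S}=c\lambda\text{ for some }c>0\}$ and, when $I_{[\lambda]}\ne\emptyset$, call $V_{[\lambda]}=\bigoplus_{i\in I_{[\lambda]}}V_i$ a coarse Lyapunov subspace. Let $H\le\mathbb Z^r$ be a subgroup of finite index, $x_1,\dots,x_l\in X$, and for $\epsilon>0$ put $$H_{\epsilon,S}=\{\mathbf n\in H:|\lambda_i(\mathbf n)|<\epsilon\ \forall i\in S,\ \|\beta_j(\mathbf n)\|<\epsilon\ \forall j\in I\},\qquad A_\epsilon=\overline{H_{\epsilon,S}.x_1}+\cdots+\overline{H_{\epsilon,S}.x_l}.$$ For a real subspace $V$ of $\mathbb R^{r_1}\oplus\mathbb C^{r_2}$, a closed set $\Omega\subset X$ contains a *$V$-pattern* if there is a sequence $(z_k)$ in $\Omega$ converging to a point $z\in\Omega$ of the form $z=z_*+v$ with $z_*$ a torsion point of $X$ and $v\in V$, such that $z_k-z\notin V$ for all $k$, where $z_k-z$ is viewed as a vector of $\mathbb R^{r_1}\oplus\mathbb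 C^{r_2}$ whose length tends to $0$ as $k\to\infty$. **Proposition 3.7.** Let $\epsilon_0>0$. If $A_{\epsilon_0}$ contains a $V_{\langle S\rangle}$-pattern, then there is $\lambda\in(P_S)^*$ with $\lambda\ne0$ and $I_{[\lambda]}\neq\emptyset$ such that for every $\epsilon>\epsilon_0$ there exist a real line $L\subset V_{[\lambda]}$ through the origin and a point $y\in X$ with $$y+L=\{y+v:v\in L\}\subset A_\epsilon .$$ -/

import Mathlib

open NumberField NumberField.mixedEmbedding Filter Topology

noncomputable section

/-- The automorphism of the torus `𝕋^d = (ℝ/ℤ)^d` given by an integer matrix `A ∈ GL(d, ℤ)`: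
`(A x)_i = ∑ j, A_{ij} x_j`. -/
def toralAut {d : ℕ} (A : Matrix.GeneralLinearGroup (Fin d) ℤ) :
    (Fin d → UnitAddCircle) →+ (Fin d → UnitAddCircle) where
  toFun x := fun i => ∑ j, (A : Matrix (Fin d) (Fin d) ℤ) i j • x j
  map_zero' := by ext i; simp
  map_add' x y := by ext i; simp [Finset.sum_add_distrib]

/-- A toral automorphism is irreducible if there is no proper invariant subtorus of positive
dimension. Subtori are the closed connected subgroups; the one of dimension `0` is `⊥`. -/
def IsIrreducibleToral {d : ℕ} (A : Matrix.GeneralLinearGroup (Fin d) ℤ) : Prop :=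
  ∀ T : AddSubgroup (Fin d → UnitAddCircle),
    IsClosed (T : Set (Fin d → UnitAddCircle)) →
    IsConnected (T : Set (Fin d → UnitAddCircle)) →
    (∀ x ∈ T, toralAut A x ∈ T) → T = ⊥ ∨ T = ⊤

/-- A toral automorphism is totally irreducible if all its nonzero powers are irreducible. -/
def IsTotallyIrreducibleToral {d : ℕ} (A : Matrix.GeneralLinearGroup (Fin d) ℤ) : Prop :=
  ∀ k : ℤ, k ≠ 0 → IsIrreducibleToral (A ^ k)

/-- The data of a multiplicative `ℤ^r`-action by units of a number field `K` on a compact quotient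
of `ℝ^{r₁} ⊕ ℂ^{r₂}`. Here `ℝ^{r₁} ⊕ ℂ^{r₂}` is `mixedSpace K`, whose coordinates are indexed by
the infinite places of `K` (this is the index set `I`), and `σ` is `mixedEmbedding K`. -/
structure UnitAction (K : Type*) [Field K] [NumberField K] (r : ℕ) where
  /-- the group embedding `n ↦ ζ^n` of `ℤ^r` into the group of units -/
  ζ : Multiplicative (Fin r → ℤ) →* (𝓞 K)ˣ
  ζ_injective : Function.Injective ζ
  /-- the cocompact lattice `Γ` -/
  Γ : AddSubgroup (mixedSpace K)
  discrete : DiscreteTopology Γ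
  cocompact : CompactSpace (mixedSpace K ⧸ Γ)
  subset_range : (Γ : Set (mixedSpace K)) ⊆ Set.range (mixedEmbedding K)
  mul_mem : ∀ (n : Multiplicative (Fin r → ℤ)), ∀ v ∈ Γ,
    mixedEmbedding K ((ζ n : 𝓞 K) : K) * v ∈ Γ

namespace UnitAction

variable {K : Type*} [Field K] [NumberField K] {r : ℕ} (M : UnitAction K r)

/-- The compact group `X = (ℝ^{r₁} ⊕ ℂ^{r₂}) / Γ`. -/
abbrev X : Type _ := mixedSpace K ⧸ M.Γ

/-- The canonical projection `π : ℝ^{r₁} ⊕ ℂ^{r₂} → X`. -/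
def proj : mixedSpace K →+ M.X := QuotientAddGroup.mk' M.Γ

/-- The unit `ζ^n` as an element of `K`. -/
def unit (n : Fin r → ℤ) : K := ((M.ζ (Multiplicative.ofAdd n) : 𝓞 K) : K)

/-- The action `x ↦ ζ^n . x` on `X`, induced by multiplication by `σ(ζ^n)`. -/
def act (n : Fin r → ℤ) : M.X →+ M.X :=
  QuotientAddGroup.map M.Γ M.Γ (AddMonoidHom.mulLeft (mixedEmbedding K (M.unit n)))
    (fun v hv => M.mul_mem (Multiplicative.ofAdd n) v hv)

theorem unit_ne_zero (n : Fin r → ℤ) : M.unit n ≠ 0 := by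
  simp [unit]

theorem unit_zero : M.unit 0 = 1 := by
  simp [unit]

theorem unit_add (m n : Fin r → ℤ) : M.unit (m + n) = M.unit m * M.unit n := by
  simp [unit, ofAdd_add]

theorem act_proj (n : Fin r → ℤ) (v : mixedSpace K) :
    M.act n (M.proj v) = M.proj (mixedEmbedding K (M.unit n) * v) := rfl

/-- The Lyapunov functional `λ_w(n) = log |ζ_w^n|` on `ℤ^r`. -/
def lyapunov (w : InfinitePlace K) : (Fin r → ℤ) →+ ℝ where
  toFun n := Real.log (w (M.unit n))
  map_zero' := by simp [unit_zero]
  map_add' m n := by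
    rw [unit_add, map_mul, Real.log_mul] <;> simp [unit_ne_zero]

/-- The argument `β_w(n) = arg ζ_w^n ∈ ℝ/2πℤ`. -/
def angle (w : InfinitePlace K) (n : Fin r → ℤ) : Real.Angle :=
  (Complex.arg (w.embedding (M.unit n)) : Real.Angle)

/-- The linear extension of the Lyapunov functional `λ_w` to `ℝ^r`. -/
def lyapunovDual (w : InfinitePlace K) : Module.Dual ℝ (Fin r → ℝ) :=
  ∑ k, M.lyapunov w (Pi.single k 1) • LinearMap.proj k

theorem lyapunovDual_intCast (w : InfinitePlace K) (n : Fin r → ℤ) :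
    M.lyapunovDual w (fun k => (n k : ℝ)) = M.lyapunov w n := by
  have h : n = ∑ k, n k • (Pi.single k 1 : Fin r → ℤ) := by
    ext i
    simp [Finset.sum_apply, Pi.single_apply]
  conv_rhs => rw [h, map_sum]
  simp only [lyapunovDual, LinearMap.sum_apply, LinearMap.smul_apply, LinearMap.proj_apply,
    smul_eq_mul]
  refine Finset.sum_congr rfl fun k _ => ?_
  rw [map_zsmul, zsmul_eq_mul, mul_comm]

/-- The subspace `L_S` of `(ℝ^r)^*` spanned by the `λ_w`, `w ∈ S`. -/
def lyapunovSpan (S : Set (InfinitePlace K)) : Submodule ℝ (Module.Dual ℝ (Fin r → ℝ)) :=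
  Submodule.span ℝ (M.lyapunovDual '' S)

/-- The set `⟨S⟩` of all `w` with `λ_w ∈ L_S`. -/
def saturation (S : Set (InfinitePlace K)) : Set (InfinitePlace K) :=
  {w | M.lyapunovDual w ∈ M.lyapunovSpan S}

/-- The subspace `P_S` of all `η ∈ ℝ^r` with `λ_w(η) = 0` for every `w ∈ S`. -/
def annihilator (S : Set (InfinitePlace K)) : Submodule ℝ (Fin r → ℝ) :=
  ⨅ w ∈ S, LinearMap.ker (M.lyapunovDual w)

/-- The set `I_{[l]}` of all `w` such that the restriction of `λ_w` to `P_S` is a positive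
multiple of `l`. -/
def coarseIndex (S : Set (InfinitePlace K)) (l : Module.Dual ℝ (M.annihilator S)) :
    Set (InfinitePlace K) :=
  {w | ∃ c : ℝ, 0 < c ∧ (M.lyapunovDual w).domRestrict (M.annihilator S) = c • l}

/-- The `ε`-slice `H_{ε,S}` of a subgroup `H` of `ℤ^r`. -/
def slice (H : AddSubgroup (Fin r → ℤ)) (S : Set (InfinitePlace K)) (ε : ℝ) :
    Set (Fin r → ℤ) :=
  {n | n ∈ H ∧ (∀ w ∈ S, |M.lyapunov w n| < ε) ∧ ∀ w, ‖M.angle w n‖ < ε}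

/-- The set `A_ε`, the sum of the closures of the partial orbits `H_{ε,S} . x_j`. -/
def orbitSum (H : AddSubgroup (Fin r → ℤ)) (S : Set (InfinitePlace K)) {l : ℕ}
    (x : Fin l → M.X) (ε : ℝ) : Set M.X :=
  {z | ∃ p : Fin l → M.X,
    (∀ j, p j ∈ closure ((fun n => M.act n (x j)) '' M.slice H S ε)) ∧ z = ∑ j, p j}

/-- `z ∈ X` is a `V`-translated torsion point: a torsion point plus a vector of `V`. -/
def IsTranslatedTorsion (V : Submodule ℝ (mixedSpace K)) (z : M.X) : Prop :=
  ∃ t : M.X, IsOfFinAddOrder t ∧ ∃ v ∈ V, z = t + M.proj v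

/-- `Ω` contains a `V`-pattern: a sequence `z_k` in `Ω` converges to a `V`-translated torsion point
`z ∈ Ω` and no `z_k - z` lies in `V`, where `z_k - z` is regarded as a vector `u_k` of
`ℝ^{r₁} ⊕ ℂ^{r₂}` whose length tends to `0`. -/
def ContainsPattern (V : Submodule ℝ (mixedSpace K)) (Ω : Set M.X) : Prop :=
  ∃ (z : M.X) (zs : ℕ → M.X) (u : ℕ → mixedSpace K),
    z ∈ Ω ∧ M.IsTranslatedTorsion V z ∧ (∀ k, zs k ∈ Ω) ∧ Tendsto zs atTop (𝓝 z) ∧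
    Tendsto u atTop (𝓝 0) ∧ (∀ k, M.proj (u k) = zs k - z) ∧ ∀ k, u k ∉ V

end UnitAction

/-- The subspace `V_J = ⨁_{w ∈ J} V_w` of `ℝ^{r₁} ⊕ ℂ^{r₂}`: the vectors whose coordinates outside
`J` vanish. -/
def placeSubspace {K : Type*} [Field K] [NumberField K] (J : Set (InfinitePlace K)) :
    Submodule ℝ (mixedSpace K) where
  carrier := {v | (∀ w : {w : InfinitePlace K // w.IsReal}, w.1 ∉ J → v.1 w = 0) ∧
    ∀ w : {w : InfinitePlace K // w.IsComplex}, w.1 ∉ J → v.2 w = 0}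
  zero_mem' := by simp
  add_mem' := by
    rintro a b ⟨ha, ha'⟩ ⟨hb, hb'⟩
    exact ⟨fun w hw => by simp [ha w hw, hb w hw], fun w hw => by simp [ha' w hw, hb' w hw]⟩
  smul_mem' := by
    rintro c a ⟨ha, ha'⟩
    exact ⟨fun w hw => by simp [ha w hw], fun w hw => by simp [ha' w hw]⟩

end

/-! Expand the pattern, then shear it. The pattern sits near `t + v` with `t` torsion and `v ∈
V_⟨S⟩`, and its small displacements have coordinates outside `⟨S⟩`. The form `λ_w` vanishes on `P_S`
exactly when `w ∈ ⟨S⟩`, so elements of `H` that fix `t` and lie near `P_S` barely change sizes in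
`V_⟨S⟩`, while a generic ray of `P_S` magnifies the displacements to size about `1`. In the limit
the only coordinates left outside `⟨S⟩` are those whose `λ_w` is positively proportional on `P_S` to
one form `lam` (`exists_expanding_times`, `exists_expanded_point`).

As `dim P_S ≥ 2`, `lam` has a nonzero kernel in `P_S`. Near that kernel lie nonzero `n ∈ H` acting
on the remaining coordinates as `1 + h` with `h` tiny, yet nonzero at every place because `ζ` is
injective. Amplifying the `V_{[lam]}` component makes the step produced by `h` point asymptotically
into `V_{[lam]}`. Iterating `n` then gives nearly equally spaced points whose spacing tends to `0`,
hence a half-line (`exists_halfLine`), and compactness turns it into a line.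

The required elements of `H` come from `exists_near_subspace`. Each application widens the slice
only slightly (`act_mem_orbitSum`), and the sets `A_ε` are closed, so the limits stay in them. -/

/-! ### Limits along ultrafilters -/

theorem IsCompact.exists_tendsto_ultrafilter {ι X : Type*} [TopologicalSpace X] {s : Set X}
    (hs : IsCompact s) (𝒰 : Ultrafilter ι) {f : ι → X} (hf : ∀ᶠ k in 𝒰, f k ∈ s) :
    ∃ x ∈ s, Tendsto f 𝒰 (𝓝 x) :=
  hs.ultrafilter_le_nhds (𝒰.map f) (le_principal_iff.2 hf)

theorem exists_tendsto_ultrafilter_of_norm_le {ι E : Type*} [NormedAddCommGroup E]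
    [ProperSpace E] (𝒰 : Ultrafilter ι) {f : ι → E} (C : ℝ) (hf : ∀ᶠ k in 𝒰, ‖f k‖ ≤ C) :
    ∃ x, Tendsto f 𝒰 (𝓝 x) := by
  obtain ⟨x, -, hx⟩ := (isCompact_closedBall (0 : E) C).exists_tendsto_ultrafilter 𝒰
    (f := f) (by simpa using hf)
  exact ⟨x, hx⟩

/-! ### Coordinatewise convergence and powers of `1 + h` -/

section MixedSpace

variable {K : Type*} [Field K]

theorem mem_placeSubspace_iff [NumberField K] {J : Set (InfinitePlace K)} {v : mixedSpace K} :
    v ∈ placeSubspace J ↔ ∀ w ∉ J, normAtPlace w v = 0 := by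
  constructor
  · rintro ⟨h₁, h₂⟩ w hw
    rcases InfinitePlace.isReal_or_isComplex w with h | h
    · rw [normAtPlace_apply_of_isReal h, h₁ ⟨w, h⟩ hw, norm_zero]
    · rw [normAtPlace_apply_of_isComplex h, h₂ ⟨w, h⟩ hw, norm_zero]
  · refine fun h => ⟨fun w hw => ?_, fun w hw => ?_⟩
    · simpa [normAtPlace_apply_of_isReal w.2] using h w.1 hw
    · simpa [normAtPlace_apply_of_isComplex w.2] using h w.1 hw

theorem tendsto_mixedSpace_iff [NumberField K] {ι : Type*} {l : Filter ι} {f : ι → mixedSpace K}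
    {a : mixedSpace K} :
    Tendsto f l (𝓝 a) ↔ ∀ w, Tendsto (fun k => normAtPlace w (f k - a)) l (𝓝 0) := by
  classical
  constructor
  · intro h w
    have := ((continuous_normAtPlace w).tendsto (a - a)).comp (h.sub_const a)
    rwa [sub_self, map_zero] at this
  · intro h
    rw [tendsto_iff_norm_sub_tendsto_zero]
    refine squeeze_zero (fun _ => norm_nonneg _) (g := fun k => ∑ w, normAtPlace w (f k - a))
      (fun k => ?_) (by simpa using tendsto_finsetSum Finset.univ fun w _ => h w)
    rw [norm_eq_sup'_normAtPlace]
    exact Finset.sup'_le _ _ fun w _ => Finset.single_le_sum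
      (f := fun w => normAtPlace w (f k - a)) (fun w _ => normAtPlace_nonneg w _)
      (Finset.mem_univ w)

theorem exists_tendsto_of_normAtPlace_le [NumberField K] {ι : Type*} (𝒰 : Ultrafilter ι) {f : ι → mixedSpace K}
    (C : ℝ) (hf : ∀ w, ∀ᶠ k in 𝒰, normAtPlace w (f k) ≤ C) : ∃ a, Tendsto f 𝒰 (𝓝 a) := by
  classical
  refine exists_tendsto_ultrafilter_of_norm_le 𝒰 C ?_
  filter_upwards [eventually_all.2 hf] with k hk
  rw [norm_eq_sup'_normAtPlace]
  exact Finset.sup'_le _ _ fun w _ => hk w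

theorem normAtPlace_one_add_pow_sub_one_le (w : InfinitePlace K) (h : mixedSpace K) (q : ℕ) :
    normAtPlace w ((1 + h) ^ q - 1) ≤ (1 + normAtPlace w h) ^ q - 1 := by
  induction q with
  | zero => simp
  | succ q ih =>
    have e : (1 + h) ^ (q + 1) - 1 = ((1 + h) ^ q - 1) * (1 + h) + h := by ring
    have h₁ : normAtPlace w (1 + h) ≤ 1 + normAtPlace w h := by
      simpa using normAtPlace_add_le w 1 h
    rw [e]
    refine (normAtPlace_add_le w _ _).trans ?_
    rw [map_mul]
    have := mul_le_mul ih h₁ (normAtPlace_nonneg w _)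
      ((normAtPlace_nonneg w _).trans ih)
    linear_combination this

theorem normAtPlace_one_add_pow_sub_linear_le (w : InfinitePlace K) (h : mixedSpace K) (q : ℕ) :
    normAtPlace w ((1 + h) ^ q - 1 - q * h) ≤
      (1 + normAtPlace w h) ^ q - 1 - q * normAtPlace w h := by
  induction q with
  | zero => simp
  | succ q ih =>
    have e : (1 + h) ^ (q + 1) - 1 - (q + 1 : ℕ) * h =
        ((1 + h) ^ q - 1 - q * h) + ((1 + h) ^ q - 1) * h := by push_cast; ring
    rw [e]
    refine (normAtPlace_add_le w _ _).trans ?_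
    rw [map_mul]
    have := mul_le_mul_of_nonneg_right (normAtPlace_one_add_pow_sub_one_le w h q)
      (normAtPlace_nonneg w h)
    push_cast
    linear_combination ih + this

/-- The real binomial bound is dominated by `exp`, and `|exp x - 1 - x| ≤ x²` for `|x| ≤ 1`. This
controls how far `q` iterated steps deviate from `q` times one step. -/
theorem normAtPlace_one_add_pow_sub_linear_le_sq (w : InfinitePlace K) (h : mixedSpace K)
    (q : ℕ) (hq : q * normAtPlace w h ≤ 1) :
    normAtPlace w ((1 + h) ^ q - 1 - q * h) ≤ (q * normAtPlace w h) ^ 2 := by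
  have h₀ := normAtPlace_nonneg w h
  have h₁ : (1 + normAtPlace w h) ^ q ≤ Real.exp (q * normAtPlace w h) := by
    rw [Real.exp_nat_mul]
    exact pow_le_pow_left₀ (by positivity) (by linarith [Real.add_one_le_exp (normAtPlace w h)]) q
  have h₂ := Real.abs_exp_sub_one_sub_id_le (x := q * normAtPlace w h)
    (by rwa [abs_of_nonneg (by positivity)])
  linarith [normAtPlace_one_add_pow_sub_linear_le w h q,
    le_abs_self (Real.exp (q * normAtPlace w h) - 1 - q * normAtPlace w h)]

end MixedSpace

/-! ### Sizes of units, orbit sums and torsion points -/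

namespace UnitAction

variable {K : Type*} [Field K] [NumberField K] {r : ℕ} (M : UnitAction K r)

theorem normAtPlace_unit (w : InfinitePlace K) (n : Fin r → ℤ) :
    normAtPlace w (mixedEmbedding K (M.unit n)) = Real.exp (M.lyapunov w n) := by
  rw [normAtPlace_apply]
  exact (Real.exp_log (InfinitePlace.pos_iff.2 (M.unit_ne_zero n))).symm

theorem angle_add (w : InfinitePlace K) (m n : Fin r → ℤ) :
    M.angle w (m + n) = M.angle w m + M.angle w n := by
  rw [angle, unit_add, map_mul, Complex.arg_mul_coe_angle] <;> simp [unit_ne_zero, angle]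

/-- The argument `n ↦ arg ζ_w^n` as a homomorphism. -/
noncomputable def angleHom (w : InfinitePlace K) : (Fin r → ℤ) →+ Real.Angle where
  toFun := M.angle w
  map_zero' := by simp [angle, unit_zero]
  map_add' := M.angle_add w

theorem norm_angle_eq (w : InfinitePlace K) (n : Fin r → ℤ) :
    ‖M.angle w n‖ = |Complex.arg (w.embedding (M.unit n))| := by
  refine (AddCircle.norm_coe_eq_abs_iff _ (by positivity)).2 ?_
  rw [abs_of_pos Real.two_pi_pos]
  linarith [Complex.abs_arg_le_pi (w.embedding (M.unit n))]

/-- Splits `z - 1` into a radial part `(|z| - 1) e^{iθ}` and an angular part `e^{iθ} - 1`. -/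
theorem normAtPlace_unit_sub_one_le (w : InfinitePlace K) (n : Fin r → ℤ) :
    normAtPlace w (mixedEmbedding K (M.unit n) - 1) ≤
      |Real.exp (M.lyapunov w n) - 1| + ‖M.angle w n‖ := by
  have e : mixedEmbedding K (M.unit n) - 1 = mixedEmbedding K (M.unit n - 1) := by simp
  rw [e, normAtPlace_apply, ← InfinitePlace.norm_embedding_eq, map_sub, map_one, norm_angle_eq,
    ← normAtPlace_unit, normAtPlace_apply, ← InfinitePlace.norm_embedding_eq]
  set z := w.embedding (M.unit n)
  have h₁ := Complex.norm_mul_exp_arg_mul_I z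
  have h₂ : z - 1 = ((‖z‖ : ℂ) - 1) * Complex.exp (z.arg * Complex.I) +
      (Complex.exp (Complex.I * z.arg) - 1) := by
    rw [mul_comm Complex.I]; linear_combination -h₁
  rw [h₂]
  refine (norm_add_le _ _).trans (add_le_add ?_ ?_)
  · rw [norm_mul, Complex.norm_exp_ofReal_mul_I, mul_one, ← Complex.ofReal_one,
      ← Complex.ofReal_sub, Complex.norm_real, Real.norm_eq_abs]
  · simpa using Real.norm_exp_I_mul_ofReal_sub_one_le (x := z.arg)

/-- Injectivity of `ζ` makes `ζ^n - 1` a nonzero element of the field `K`, so no place can kill it.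
-/
theorem normAtPlace_unit_sub_one_pos (w : InfinitePlace K) {n : Fin r → ℤ} (hn : n ≠ 0) :
    0 < normAtPlace w (mixedEmbedding K (M.unit n) - 1) := by
  have e : mixedEmbedding K (M.unit n) - 1 = mixedEmbedding K (M.unit n - 1) := by simp
  rw [e, normAtPlace_apply, InfinitePlace.pos_iff, sub_ne_zero]
  intro h
  apply hn
  have : M.ζ (Multiplicative.ofAdd n) = M.ζ 1 := by
    rw [map_one]
    ext
    simpa [unit] using h
  simpa using M.ζ_injective this

theorem unit_nsmul (q : ℕ) (n : Fin r → ℤ) : M.unit (q • n) = M.unit n ^ q := by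
  induction q with
  | zero => simp [unit_zero]
  | succ q ih => rw [succ_nsmul, unit_add, ih, pow_succ]

theorem act_add (m n : Fin r → ℤ) (z : M.X) : M.act (m + n) z = M.act m (M.act n z) := by
  induction z using QuotientAddGroup.induction_on with
  | H v =>
    change M.act _ (M.proj v) = M.act _ (M.act _ (M.proj v))
    simp [act_proj, unit_add, mul_assoc]

theorem act_zero (z : M.X) : M.act 0 z = z := by
  induction z using QuotientAddGroup.induction_on with
  | H v =>
    change M.act _ (M.proj v) = M.proj v
    simp [act_proj, unit_zero]

theorem continuous_proj : Continuous M.proj := continuous_quot_mk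

theorem continuous_act (n : Fin r → ℤ) : Continuous (M.act n) := by
  refine continuous_quot_lift _ ?_
  exact M.continuous_proj.comp (continuous_const.mul continuous_id)

theorem isClosed_lattice : IsClosed (M.Γ : Set (mixedSpace K)) :=
  have := M.discrete
  AddSubgroup.isClosed_of_discrete

theorem t2Space : T2Space M.X :=
  have := M.isClosed_lattice
  inferInstance

theorem add_mem_slice {H : AddSubgroup (Fin r → ℤ)} {S : Set (InfinitePlace K)} {ε δ : ℝ}
    {m n : Fin r → ℤ} (hm : m ∈ M.slice H S ε) (hn : n ∈ M.slice H S δ) :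
    m + n ∈ M.slice H S (ε + δ) := by
  refine ⟨H.add_mem hm.1 hn.1, fun w hw => ?_, fun w => ?_⟩
  · rw [map_add]
    exact (abs_add_le _ _).trans_lt (add_lt_add (hm.2.1 w hw) (hn.2.1 w hw))
  · rw [angle_add]
    exact (norm_add_le _ _).trans_lt (add_lt_add (hm.2.2 w) (hn.2.2 w))

theorem act_mem_orbitSum {H : AddSubgroup (Fin r → ℤ)} {S : Set (InfinitePlace K)} {l : ℕ}
    {x : Fin l → M.X} {ε δ : ℝ} {z : M.X} {m : Fin r → ℤ} (hm : m ∈ M.slice H S δ)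
    (hz : z ∈ M.orbitSum H S x ε) : M.act m z ∈ M.orbitSum H S x (ε + δ) := by
  obtain ⟨p, hp, rfl⟩ := hz
  refine ⟨fun j => M.act m (p j), fun j => ?_, map_sum _ _ _⟩
  refine map_mem_closure (M.continuous_act m) (hp j) ?_
  rintro _ ⟨n, hn, rfl⟩
  refine ⟨n + m, M.add_mem_slice hn hm, ?_⟩
  rw [add_comm]
  exact M.act_add m n (x j)

theorem isClosed_orbitSum (H : AddSubgroup (Fin r → ℤ)) (S : Set (InfinitePlace K)) {l : ℕ}
    (x : Fin l → M.X) (ε : ℝ) : IsClosed (M.orbitSum H S x ε) := by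
  have := M.t2Space
  have := M.cocompact
  have e : M.orbitSum H S x ε = (fun p : Fin l → M.X => ∑ j, p j) ''
      Set.univ.pi fun j => closure ((fun n => M.act n (x j)) '' M.slice H S ε) := by
    ext z
    simp [orbitSum, eq_comm]
  rw [e]
  refine (IsCompact.image (isCompact_univ_pi fun j => isClosed_closure.isCompact) ?_).isClosed
  exact continuous_finsetSum _ fun j _ => continuous_apply j

/-- The stabilizer of a point of `X`. -/
noncomputable def stabilizer (t : M.X) : AddSubgroup (Fin r → ℤ) where
  carrier := {n | M.act n t = t}
  zero_mem' := M.act_zero t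
  add_mem' {m n} hm hn := by
    change M.act _ _ = _
    rw [act_add, show M.act n t = t from hn, show M.act m t = t from hm]
  neg_mem' {n} hn := by
    change M.act _ _ = _
    conv_lhs => rw [← show M.act n t = t from hn]
    rw [← act_add, neg_add_cancel, act_zero]

/-- The set is closed in a compact space, and it is discrete: if two of its points differ by a small
vector `v`, then `N • v` is a short lattice vector, hence `0`. -/
theorem finite_torsion {N : ℕ} (hN : N ≠ 0) : {t : M.X | N • t = 0}.Finite := by
  have := M.t2Space
  have := M.cocompact
  have hcl : IsClosed {t : M.X | N • t = 0} :=
    isClosed_eq (continuous_const_smul N) continuous_const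
  refine hcl.isCompact.finite ⟨discreteTopology_subtype_iff'.2 fun t ht => ?_⟩
  obtain ⟨U, hU, hUΓ⟩ := discreteTopology_subtype_iff'.1 M.discrete 0 M.Γ.zero_mem
  have h₀ : (0 : mixedSpace K) ∈ U := by
    have : (0 : mixedSpace K) ∈ U ∩ (M.Γ : Set (mixedSpace K)) := hUΓ ▸ rfl
    exact this.1
  refine ⟨(fun s => s - t) ⁻¹' (M.proj '' ((fun v => N • v) ⁻¹' U)), ?_, ?_⟩
  · refine IsOpen.preimage (continuous_id.sub continuous_const) ?_
    exact QuotientAddGroup.isOpenMap_coe _ (hU.preimage (continuous_const_smul N))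
  · ext s
    constructor
    · rintro ⟨⟨v, hv, hvs⟩, hs⟩
      have hs : N • s = 0 := hs
      have ht : N • t = 0 := ht
      have h : N • v ∈ M.Γ := by
        rw [← QuotientAddGroup.eq_zero_iff]
        change M.proj (N • v) = 0
        rw [map_nsmul, hvs, nsmul_sub, hs, ht, sub_zero]
      have h₁ : N • v = 0 := by
        have : N • v ∈ U ∩ (M.Γ : Set (mixedSpace K)) := ⟨hv, h⟩
        rwa [hUΓ] at this
      have h₂ : v = 0 := by
        rw [← Nat.cast_smul_eq_nsmul ℝ] at h₁
        exact (smul_eq_zero.1 h₁).resolve_left (Nat.cast_ne_zero.2 hN)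
      rw [h₂, map_zero] at hvs
      exact sub_eq_zero.1 hvs.symm
    · rintro rfl
      exact ⟨⟨0, by simpa using h₀, by simp⟩, ht⟩

/-- The orbit of `t` stays in the finite set of points killed by the order of `t`. -/
theorem finiteIndex_stabilizer {t : M.X} (ht : IsOfFinAddOrder t) :
    (M.stabilizer t).FiniteIndex := by
  have hN := ht.addOrderOf_pos.ne'
  have : Finite {s : M.X | addOrderOf t • s = 0} := M.finite_torsion hN
  let f : (Fin r → ℤ) ⧸ M.stabilizer t → {s : M.X | addOrderOf t • s = 0} :=
    Quotient.lift (fun n => ⟨M.act n t, by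
      rw [Set.mem_ofPred_eq, ← map_nsmul, addOrderOf_nsmul_eq_zero, map_zero]⟩) (by
      intro m n h
      have h : -m + n ∈ M.stabilizer t := QuotientAddGroup.leftRel_apply.1 h
      ext
      change M.act m t = M.act n t
      have h : M.act (-m + n) t = t := h
      rw [← h, ← act_add, add_neg_cancel_left, h])
  have hf : Function.Injective f := by
    intro a b
    induction a using QuotientAddGroup.induction_on with
    | H m =>
    induction b using QuotientAddGroup.induction_on with
    | H n =>
    intro h
    have h : M.act m t = M.act n t := congrArg Subtype.val h
    rw [QuotientAddGroup.eq]
    change M.act _ _ = _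
    rw [act_add, ← h, ← act_add, neg_add_cancel, act_zero]
  have := Finite.of_injective f hf
  exact AddSubgroup.finiteIndex_of_finite_quotient

/-! ### Approximating a real subspace by elements of a finite index subgroup -/

/-- A real lift, extended linearly to `ℝ^r`, of the argument `n ↦ arg ζ_w^n`. -/
noncomputable def angleLift (w : InfinitePlace K) : Module.Dual ℝ (Fin r → ℝ) :=
  ∑ k, Complex.arg (w.embedding (M.unit (Pi.single k 1))) • LinearMap.proj k

theorem angleLift_intCast (w : InfinitePlace K) (n : Fin r → ℤ) :
    ((M.angleLift w (fun k => (n k : ℝ)) : ℝ) : Real.Angle) = M.angle w n := by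
  have h : n = ∑ k, n k • (Pi.single k 1 : Fin r → ℤ) := by
    ext i
    simp [Finset.sum_apply, Pi.single_apply]
  conv_rhs => rw [h, ← show M.angleHom w _ = M.angle w _ from rfl, map_sum]
  simp only [angleLift, LinearMap.sum_apply, LinearMap.smul_apply, LinearMap.proj_apply,
    smul_eq_mul]
  rw [← Real.Angle.coe_coeHom, map_sum]
  refine Finset.sum_congr rfl fun k _ => ?_
  rw [map_zsmul, mul_comm, ← zsmul_eq_mul, map_zsmul]
  rfl

theorem exists_bound_dual {ι : Type*} [Finite ι] (f : ι → Module.Dual ℝ (Fin r → ℝ)) :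
    ∃ C, 0 ≤ C ∧ ∀ i η, |f i η| ≤ C * ‖η‖ := by
  cases nonempty_fintype ι
  refine ⟨∑ i, ‖LinearMap.toContinuousLinearMap (f i)‖, by positivity, fun i η => ?_⟩
  refine ((LinearMap.toContinuousLinearMap (f i)).le_opNorm η).trans ?_
  gcongr
  exact Finset.single_le_sum (f := fun i => ‖LinearMap.toContinuousLinearMap (f i)‖)
    (fun _ _ => norm_nonneg _) (Finset.mem_univ i)

/-- Simultaneous approximation: points of a real subspace `P` are, up to a bounded error, close to
elements of a finite index subgroup that are almost in `P` and almost have trivial angles. -/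
theorem exists_near_subspace (H : AddSubgroup (Fin r → ℤ)) [hH : H.FiniteIndex]
    (P : Submodule ℝ (Fin r → ℝ)) {δ : ℝ} (hδ : 0 < δ) :
    ∃ C, ∀ η ∈ P, ∃ n ∈ H, (∀ w, ‖M.angle w n‖ < δ) ∧
      ∃ η' ∈ P, ‖(fun k => (n k : ℝ)) - η'‖ < δ ∧ ‖η - η'‖ ≤ C := by
  set N := H.index with hN
  have hN₀ : (0 : ℝ) < N := by exact_mod_cast Nat.pos_of_ne_zero hH.index_ne_zero
  obtain ⟨B, hB₀, hB⟩ := exists_bound_dual (fun w => M.angleLift w)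
  -- Leaves room for three errors: `ε` for the angles at `ξ`, `N ε` for rounding, and `B N ε` for
  -- the effect of rounding on the angles.
  set ε := δ / (1 + N + B * N) with hε
  have hε₀ : 0 < ε := by positivity
  have hεδ : ε + B * (N * ε) + N * ε = δ := by rw [hε]; field_simp; ring
  -- A vector with `F` near `0` is close to `N` times an integer vector, which lies in `H`, and has
  -- all lifted angles near `0`. A finite net of `F '' P` by points `f ∈ P` allows any `η` to be
  -- corrected to such a vector `η - f`; the bound on the finitely many `f` is `C`.
  let F : (Fin r → ℝ) →+ (Fin r → UnitAddCircle) × (InfinitePlace K → Real.Angle) :=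
    { toFun := fun η => (fun k => ((η k / N : ℝ) : UnitAddCircle),
        fun w => ((M.angleLift w η : ℝ) : Real.Angle))
      map_zero' := by ext <;> simp
      map_add' := fun a b => by ext <;> simp [add_div] }
  have : CompactSpace Real.Angle :=
    have : Fact (0 < 2 * Real.pi) := ⟨Real.two_pi_pos⟩
    inferInstanceAs (CompactSpace (AddCircle (2 * Real.pi)))
  have hT : TotallyBounded (F '' P) := (isCompact_univ.totallyBounded).subset (Set.subset_univ _)
  have h₀ := Metric.finite_approx_of_totallyBounded hT ε hε₀
  obtain ⟨T, hTP, hTfin, hT⟩ := (Set.exists_subset_image_finite_and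
    (p := fun t => F '' P ⊆ ⋃ y ∈ t, Metric.ball y ε)).1 h₀
  obtain ⟨C, hC⟩ := hTfin.isBounded.exists_norm_le
  refine ⟨C, fun η hη => ?_⟩
  obtain ⟨f, hf, hfη⟩ : ∃ f ∈ T, dist (F η) (F f) < ε := by
    simpa using hT ⟨η, hη, rfl⟩
  have hdist : ‖F (η - f)‖ < ε := by rwa [map_sub, ← dist_eq_norm]
  set ξ := η - f with hξ
  set m : Fin r → ℤ := fun k => round (ξ k / N) with hm
  have hn : ‖(fun k => ((N • m) k : ℝ)) - ξ‖ ≤ N * ε := by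
    refine (pi_norm_le_iff_of_nonneg (by positivity)).2 fun k => ?_
    have h₁ : ‖((ξ k / N : ℝ) : UnitAddCircle)‖ < ε :=
      ((norm_le_pi_norm (F ξ).1 k).trans (norm_fst_le _)).trans_lt hdist
    rw [UnitAddCircle.norm_eq] at h₁
    have h₂ : ((N • m) k : ℝ) - ξ k = -(N * (ξ k / N - round (ξ k / N))) := by
      simp [hm]; field_simp; ring
    rw [Pi.sub_apply, h₂, norm_neg, norm_mul, Real.norm_natCast, Real.norm_eq_abs]
    gcongr
  refine ⟨N • m, H.nsmul_index_mem m, fun w => ?_, ξ, P.sub_mem hη (hTP hf), ?_, ?_⟩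
  · have h₁ : ‖((M.angleLift w ξ : ℝ) : Real.Angle)‖ < ε :=
      ((norm_le_pi_norm (F ξ).2 w).trans (norm_snd_le _)).trans_lt hdist
    have h₂ : M.angle w (N • m) = ((M.angleLift w ξ : ℝ) : Real.Angle) +
        ((M.angleLift w ((fun k => ((N • m) k : ℝ)) - ξ) : ℝ) : Real.Angle) := by
      rw [← angleLift_intCast, ← Real.Angle.coe_add, ← map_add, add_sub_cancel]
    have h₃ : ‖((M.angleLift w ((fun k => ((N • m) k : ℝ)) - ξ) : ℝ) : Real.Angle)‖ ≤
        B * (N * ε) :=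
      (QuotientAddGroup.norm_mk_le_norm).trans
        ((hB w _).trans (mul_le_mul_of_nonneg_left hn hB₀))
    rw [h₂]
    refine (norm_add_le _ _).trans_lt ?_
    nlinarith
  · refine hn.trans_lt ?_
    nlinarith [mul_nonneg hB₀ (mul_pos hN₀ hε₀).le]
  · simpa [hξ] using hC f hf

theorem exists_near_lyapunov (H : AddSubgroup (Fin r → ℤ)) [H.FiniteIndex]
    (P : Submodule ℝ (Fin r → ℝ)) {δ : ℝ} (hδ : 0 < δ) :
    ∃ C, ∀ η ∈ P, ∃ n ∈ H, (∀ w, ‖M.angle w n‖ < δ) ∧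
      (∀ w, (∀ ξ ∈ P, M.lyapunovDual w ξ = 0) → |M.lyapunov w n| < δ) ∧
      ∀ w, |M.lyapunov w n - M.lyapunovDual w η| ≤ C := by
  obtain ⟨B, hB₀, hB⟩ := exists_bound_dual (fun w => M.lyapunovDual w)
  set ε := δ / (1 + B) with hε
  have hε₀ : 0 < ε := by positivity
  have hεδ : ε + B * ε = δ := by rw [hε]; field_simp
  obtain ⟨C, hC⟩ := M.exists_near_subspace H P hε₀
  refine ⟨B * (ε + C), fun η hη => ?_⟩
  obtain ⟨n, hn, hang, η', hη', h₁, h₂⟩ := hC η hη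
  refine ⟨n, hn, fun w => (hang w).trans_le (by nlinarith), fun w hw => ?_, fun w => ?_⟩
  · have h₃ := hB w ((fun k => (n k : ℝ)) - η')
    rw [map_sub, lyapunovDual_intCast, hw η' hη', sub_zero] at h₃
    nlinarith
  · have h₃ := hB w ((fun k => (n k : ℝ)) - η)
    rw [map_sub, lyapunovDual_intCast] at h₃
    refine h₃.trans (mul_le_mul_of_nonneg_left ?_ hB₀)
    have h₄ := norm_sub_le_norm_sub_add_norm_sub (fun k => (n k : ℝ)) η' η
    rw [norm_sub_rev η' η] at h₄
    linarith

theorem exists_ne_zero_small (H : AddSubgroup (Fin r → ℤ)) [H.FiniteIndex]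
    {P : Submodule ℝ (Fin r → ℝ)} (hP : P ≠ ⊥) {δ : ℝ} (hδ : 0 < δ) :
    ∃ n ∈ H, n ≠ 0 ∧ (∀ w, ‖M.angle w n‖ < δ) ∧
      ∀ w, (∀ ξ ∈ P, M.lyapunovDual w ξ = 0) → |M.lyapunov w n| < δ := by
  obtain ⟨B, hB₀, hB⟩ := exists_bound_dual (fun w => M.lyapunovDual w)
  set ε := δ / (1 + B) with hε
  have hε₀ : 0 < ε := by positivity
  have hεδ : ε + B * ε = δ := by rw [hε]; field_simp
  obtain ⟨C, hC⟩ := M.exists_near_subspace H P hε₀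
  obtain ⟨ξ, hξ, hξ₀⟩ := Submodule.exists_mem_ne_zero_of_ne_bot hP
  have hξ₁ : 0 < ‖ξ‖ := norm_pos_iff.2 hξ₀
  have hC₀ : 0 ≤ C := by
    obtain ⟨_, _, _, _, _, _, h⟩ := hC ξ hξ
    exact (norm_nonneg _).trans h
  -- The chosen vector has norm `C + ε`, just too long to be approximated by `n = 0`.
  obtain ⟨n, hn, hang, η', hη', h₁, h₂⟩ :=
    hC (((C + ε) / ‖ξ‖) • ξ) (P.smul_mem _ hξ)
  refine ⟨n, hn, ?_, fun w => (hang w).trans_le (by nlinarith), fun w hw => ?_⟩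
  · rintro rfl
    have h₃ : ‖((C + ε) / ‖ξ‖) • ξ‖ = C + ε := by
      rw [_root_.norm_smul, Real.norm_of_nonneg (by positivity), div_mul_cancel₀ _ hξ₁.ne']
    have h₄ : ‖η'‖ < ε := by
      rw [← norm_neg]
      refine lt_of_eq_of_lt (congrArg _ ?_) h₁
      ext; simp
    have h₅ := norm_le_norm_sub_add (((C + ε) / ‖ξ‖) • ξ) η'
    linarith
  · have h₃ := hB w ((fun k => (n k : ℝ)) - η')
    rw [map_sub, lyapunovDual_intCast, hw η' hη', sub_zero] at h₃
    nlinarith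

/-! ### Duality between `L_S` and `P_S` -/

theorem mem_annihilator {S : Set (InfinitePlace K)} {η : Fin r → ℝ} :
    η ∈ M.annihilator S ↔ ∀ w ∈ S, M.lyapunovDual w η = 0 := by
  simp [annihilator]

theorem annihilator_eq (S : Set (InfinitePlace K)) :
    M.annihilator S = (M.lyapunovSpan S).dualCoannihilator := by
  ext η
  rw [mem_annihilator, Submodule.mem_dualCoannihilator]
  constructor
  · intro h φ hφ
    induction hφ using Submodule.span_induction with
    | mem φ hφ => obtain ⟨w, hw, rfl⟩ := hφ; exact h w hw
    | zero => rfl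
    | add φ ψ _ _ h₁ h₂ => rw [LinearMap.add_apply, h₁, h₂, add_zero]
    | smul c φ _ h₁ => rw [LinearMap.smul_apply, h₁, smul_zero]
  · exact fun h w hw => h _ (Submodule.subset_span ⟨w, hw, rfl⟩)

/-- Double annihilator of the finite-dimensional space `L_S`. -/
theorem mem_saturation_iff {S : Set (InfinitePlace K)} {w : InfinitePlace K} :
    w ∈ M.saturation S ↔ ∀ ξ ∈ M.annihilator S, M.lyapunovDual w ξ = 0 := by
  rw [annihilator_eq, ← Submodule.mem_dualAnnihilator, Subspace.dualCoannihilator_dualAnnihilator_eq]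
  rfl

theorem two_le_finrank_annihilator {S : Set (InfinitePlace K)}
    (hS : Module.finrank ℝ (M.lyapunovSpan S) + 2 ≤ r) :
    2 ≤ Module.finrank ℝ (M.annihilator S) := by
  have h := Subspace.finrank_add_finrank_dualCoannihilator_eq (M.lyapunovSpan S)
  rw [annihilator_eq]
  rw [Module.finrank_fin_fun] at h
  omega

end UnitAction

/-! ### Choosing the expansion times -/

theorem Ultrafilter.exists_eventually_eq {α ι : Type*} [Finite ι] (𝒰 : Ultrafilter α)
    (f : α → ι) : ∃ i, ∀ᶠ k in 𝒰, f k = i := by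
  obtain ⟨i, hi⟩ := Ultrafilter.eq_pure_of_finite (𝒰.map f)
  refine ⟨i, ?_⟩
  have : {i} ∈ 𝒰.map f := by rw [hi]; exact rfl
  exact this

/-- Given finitely many nonzero linear forms `f j` and vanishing amplitudes `a k j`, one can choose
times `t k` along a fixed direction `η` such that the amplified amplitudes
`a k j * exp (t k * f j η)` have maximum `1`, and only those with `f j` positively proportional
to a single form survive in the limit. -/
theorem exists_expanding_times {ι V : Type*} [Finite ι] [AddCommGroup V] [Module ℝ V]
    (f : ι → Module.Dual ℝ V) (hf : ∀ j, f j ≠ 0) (𝒰 : Ultrafilter ℕ) {a : ℕ → ι → ℝ}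
    (ha₀ : ∀ k j, 0 ≤ a k j) (ha : ∀ j, Tendsto (fun k => a k j) 𝒰 (𝓝 0))
    (hne : ∀ k, ∃ j, a k j ≠ 0) :
    ∃ φ : Module.Dual ℝ V, φ ≠ 0 ∧ (∃ j, ∃ c : ℝ, 0 < c ∧ f j = c • φ) ∧
      ∃ (η : V) (t : ℕ → ℝ),
        (∀ᶠ k in 𝒰, (∀ j, a k j * Real.exp (t k * f j η) ≤ 1) ∧
          ∃ j, a k j * Real.exp (t k * f j η) = 1) ∧
        ∀ j, (¬ ∃ c : ℝ, 0 < c ∧ f j = c • φ) →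
          Tendsto (fun k => a k j * Real.exp (t k * f j η)) 𝒰 (𝓝 0) := by
  have : Nonempty ι := ⟨(hne 0).choose⟩
  choose j₀ hj₀ using fun k => Finite.exists_max (a k)
  obtain ⟨i₀, hi₀⟩ := 𝒰.exists_eventually_eq j₀
  have hmax : ∀ᶠ k in 𝒰, (∀ j, a k j ≤ a k i₀) ∧ 0 < a k i₀ := by
    filter_upwards [hi₀] with k hk
    rw [← hk]
    obtain ⟨j, hj⟩ := hne k
    exact ⟨hj₀ k, ((ha₀ k j).lt_of_ne' hj).trans_le (hj₀ k j)⟩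
  have hlt : ∀ᶠ k in 𝒰, ∀ j, a k j < 1 :=
    eventually_all.2 fun j => (ha j).eventually_lt_const one_pos
  -- Amplitude `j` reaches `1` at time `-log (a k j) / f j η`, so up to a factor independent of `j`
  -- the inverse of that time is `ρ k j * f j η`. If `a k j = 0`, the conventions `log 0 = 0` and `x
  -- / 0 = 0` give `ρ k j = 0`.
  set ρ : ℕ → ι → ℝ := fun k j => Real.log (a k i₀) / Real.log (a k j) with hρ
  have hlog : ∀ᶠ k in 𝒰, Real.log (a k i₀) < 0 := by
    filter_upwards [hmax, hlt] with k h₁ h₂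
    exact Real.log_neg h₁.2 (h₂ i₀)
  have hlogle : ∀ᶠ k in 𝒰, ∀ j, a k j ≠ 0 → Real.log (a k j) ≤ Real.log (a k i₀) := by
    filter_upwards [hmax] with k h₁ j hj
    exact Real.log_le_log ((ha₀ k j).lt_of_ne' hj) (h₁.1 j)
  have hρ₀₁ : ∀ᶠ k in 𝒰, ∀ j, ρ k j ∈ Set.Icc (0 : ℝ) 1 := by
    filter_upwards [hlogle, hlog] with k h₁ h₂ j
    by_cases hj : a k j = 0
    · simp [hρ, hj]
    · have h₃ := (h₁ j hj).trans_lt h₂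
      exact ⟨div_nonneg_of_nonpos h₂.le h₃.le, (div_le_one_of_neg h₃).2 (h₁ j hj)⟩
  choose r hr₀₁ hr using fun j => (isCompact_Icc (a := (0 : ℝ)) (b := 1)).exists_tendsto_ultrafilter
    𝒰 (f := fun k => ρ k j) (hρ₀₁.mono fun k h => h j)
  have hri₀ : r i₀ = 1 := by
    refine tendsto_nhds_unique (hr i₀) (tendsto_const_nhds.congr' ?_)
    filter_upwards [hlog] with k hk
    exact (div_self hk.ne).symm
  -- A generic `η` separates the distinct forms among the `r j • f j`, so a tie for the maximum at
  -- `η` forces proportional forms. Replacing `η` by `-η` keeps this and makes the maximum positive.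
  obtain ⟨η, hη, hηi₀⟩ : ∃ η : V, (∀ i j, r i * f i η = r j * f j η → r i • f i = r j • f j) ∧
      0 < f i₀ η := by
    obtain ⟨η, hη⟩ := Module.Dual.exists_forall_ne_zero_of_forall_exists
      (K := ℝ) (M := V)
      (fun p : {p : ι × ι // r p.1 • f p.1 ≠ r p.2 • f p.2} ⊕ Unit =>
        Sum.elim (fun p => r p.1.1 • f p.1.1 - r p.1.2 • f p.1.2) (fun _ => f i₀) p) (by
        rintro (p | p)
        · by_contra! h
          exact p.2 (sub_eq_zero.1 (LinearMap.ext h))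
        · by_contra! h
          exact hf i₀ (LinearMap.ext h))
    have h₁ : ∀ i j, r i * f i η = r j * f j η → r i • f i = r j • f j := by
      intro i j h
      by_contra hij
      refine hη (Sum.inl ⟨(i, j), hij⟩) ?_
      simpa [sub_eq_zero] using h
    have h₂ : f i₀ η ≠ 0 := hη (Sum.inr ())
    rcases h₂.lt_or_gt with h | h
    · exact ⟨-η, fun i j hij => h₁ i j (by simpa using hij), by simpa using h⟩
    · exact ⟨η, h₁, h⟩
  obtain ⟨j₁, hj₁⟩ := Finite.exists_max fun j => r j * f j η
  set G := r j₁ * f j₁ η with hG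
  have hG₀ : 0 < G := by
    have := hj₁ i₀
    rw [hri₀, one_mul] at this
    exact hηi₀.trans_le this
  have hclass : ∀ j, r j * f j η = G → ∃ c : ℝ, 0 < c ∧ f j = c • (r j₁ • f j₁) := by
    intro j hj
    have hrj : r j ≠ 0 := by rintro h; rw [h, zero_mul] at hj; exact hG₀.ne hj
    refine ⟨(r j)⁻¹, inv_pos.2 ((hr₀₁ j).1.lt_of_ne' hrj), ?_⟩
    rw [← hη j j₁ hj, smul_smul, inv_mul_cancel₀ hrj, one_smul]
  -- The maximizer at stage `k` is the first amplitude to reach `1`; `t k` is the time when it does.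
  choose m₂ hm₂ using fun k => Finite.exists_max fun j => ρ k j * f j η
  obtain ⟨j₂, hj₂⟩ := 𝒰.exists_eventually_eq m₂
  set s : ℕ → ℝ := fun k => ρ k j₂ * f j₂ η with hs
  have hsmax : ∀ᶠ k in 𝒰, ∀ j, ρ k j * f j η ≤ s k := by
    filter_upwards [hj₂] with k hk j
    have := hm₂ k j
    rwa [hk] at this
  have hs₁ : Tendsto s 𝒰 (𝓝 (r j₂ * f j₂ η)) := (hr j₂).mul_const _
  have hsG : r j₂ * f j₂ η = G :=
    le_antisymm (hj₁ j₂) (le_of_tendsto_of_tendsto ((hr j₁).mul_const _) hs₁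
      (hsmax.mono fun k h => h j₁))
  rw [hsG] at hs₁
  have hs₀ : ∀ᶠ k in 𝒰, 0 < s k := hs₁.eventually_const_lt hG₀
  set t : ℕ → ℝ := fun k => -Real.log (a k i₀) / s k with ht
  have key : ∀ᶠ k in 𝒰, ∀ j, a k j ≠ 0 → a k j * Real.exp (t k * f j η) =
      Real.exp (Real.log (a k j) * (1 - ρ k j * f j η / s k)) := by
    filter_upwards [hs₀, hlogle, hlog] with k h₁ h₂ h₃ j hj
    have h₄ := ((h₂ j hj).trans_lt h₃).ne
    conv_lhs => rw [← Real.exp_log ((ha₀ k j).lt_of_ne' hj), ← Real.exp_add]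
    congr 1
    simp only [ht, hρ]
    field_simp
    ring
  refine ⟨r j₁ • f j₁, ?_, ⟨j₁, hclass j₁ rfl⟩, η, t, ?_, fun j hj => ?_⟩
  · intro h
    have := LinearMap.congr_fun h η
    exact hG₀.ne' (by simpa [hG] using this)
  · filter_upwards [key, hs₀, hsmax, hlogle, hlog] with k h₁ h₂ h₃ h₄ h₅
    refine ⟨fun j => ?_, j₂, ?_⟩
    · by_cases hj : a k j = 0
      · simp [hj]
      · rw [h₁ j hj, Real.exp_le_one_iff]
        refine mul_nonpos_of_nonpos_of_nonneg ((h₄ j hj).trans h₅.le) ?_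
        rw [sub_nonneg]
        exact (div_le_one h₂).2 (h₃ j)
    · have hj : a k j₂ ≠ 0 := by
        intro h
        simp [hs, hρ, h] at h₂
      rw [h₁ j₂ hj, Real.exp_eq_one_iff]
      change _ * (1 - s k / s k) = 0
      rw [div_self h₂.ne', sub_self, mul_zero]
  -- A form that does not attain the maximum `G` leaves the exponent at most `κ * log (a k i₀)`,
  -- which tends to `-∞`.
  · have h₁ : r j * f j η / G < 1 :=
      (div_lt_one hG₀).2 ((hj₁ j).lt_of_ne fun h => hj (hclass j h))
    have h₂ : Tendsto (fun k => 1 - ρ k j * f j η / s k) 𝒰 (𝓝 (1 - r j * f j η / G)) :=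
      (((hr j).mul_const _).div hs₁ hG₀.ne').const_sub 1
    set κ := (1 - r j * f j η / G) / 2 with hκ
    have hκ₀ : 0 < κ := by linarith
    have h₃ := h₂.eventually_const_lt (show κ < 1 - r j * f j η / G by linarith)
    have h₄ : Tendsto (fun k => Real.exp (κ * Real.log (a k i₀))) 𝒰 (𝓝 0) := by
      refine Real.tendsto_exp_atBot.comp (Tendsto.const_mul_atBot hκ₀ ?_)
      refine Real.tendsto_log_nhdsGT_zero.comp (tendsto_nhdsWithin_iff.2 ⟨ha i₀, ?_⟩)
      exact hmax.mono fun k h => h.2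
    refine squeeze_zero' (.of_forall fun k => mul_nonneg (ha₀ k j) (Real.exp_nonneg _)) ?_ h₄
    filter_upwards [key, h₃, hlogle, hlog] with k h₅ h₆ h₇ h₈
    by_cases hj : a k j = 0
    · rw [hj, zero_mul]; positivity
    · rw [h₅ j hj, Real.exp_le_exp]
      nlinarith [h₇ j hj]

theorem normAtPlace_add_of_eq_zero {K : Type*} [Field K] {w : InfinitePlace K}
    {v : mixedSpace K} (hv : normAtPlace w v = 0) (u : mixedSpace K) :
    normAtPlace w (v + u) = normAtPlace w u := by
  refine le_antisymm (by simpa [hv] using normAtPlace_add_le w v u) ?_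
  simpa [hv, normAtPlace_neg] using normAtPlace_add_le w (-v) (v + u)

/-! ### Expanding the pattern -/

namespace UnitAction

variable {K : Type*} [Field K] [NumberField K] {r : ℕ} (M : UnitAction K r)

theorem act_add_proj_of_mem_stabilizer {t : M.X} {n : Fin r → ℤ} (hn : n ∈ M.stabilizer t)
    (v : mixedSpace K) :
    M.act n (t + M.proj v) = t + M.proj (mixedEmbedding K (M.unit n) * v) := by
  rw [map_add, act_proj, show M.act n t = t from hn]

theorem subset_saturation (S : Set (InfinitePlace K)) : S ⊆ M.saturation S :=
  fun w hw => Submodule.subset_span ⟨w, hw, rfl⟩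

/-- Expanding a pattern produces, in slightly larger orbit sums, a point that differs from a
torsion point by a vector with a nontrivial component in a coarse Lyapunov subspace. -/
theorem exists_expanded_point {S : Set (InfinitePlace K)} {H : AddSubgroup (Fin r → ℤ)}
    [H.FiniteIndex] {l : ℕ} {x : Fin l → M.X} {ε₀ : ℝ}
    (hpat : M.ContainsPattern (placeSubspace (M.saturation S)) (M.orbitSum H S x ε₀)) :
    ∃ lam : Module.Dual ℝ (M.annihilator S), lam ≠ 0 ∧ (M.coarseIndex S lam).Nonempty ∧
      ∃ t : M.X, IsOfFinAddOrder t ∧ ∀ δ : ℝ, 0 < δ →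
        ∃ v ∈ placeSubspace (M.saturation S ∪ M.coarseIndex S lam),
          (∃ i ∈ M.coarseIndex S lam, normAtPlace i v ≠ 0) ∧
          t + M.proj v ∈ M.orbitSum H S x (ε₀ + δ) := by
  obtain ⟨z, zs, u, -, ⟨t, ht, v, hv, rfl⟩, hzs, -, hu, hpu, hunot⟩ := hpat
  rw [mem_placeSubspace_iff] at hv
  set 𝒰 : Ultrafilter ℕ := hyperfilter ℕ
  have hu𝒰 : Tendsto u 𝒰 (𝓝 0) := hu.mono_left Nat.hyperfilter_le_atTop
  have hua : ∀ w, Tendsto (fun k => normAtPlace w (u k)) 𝒰 (𝓝 0) := by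
    simpa using tendsto_mixedSpace_iff.1 hu𝒰
  obtain ⟨lam, hlam, ⟨j₀, hj₀⟩, η, τ, hτ, hτ₀⟩ := exists_expanding_times
    (fun j : {w // w ∉ M.saturation S} => (M.lyapunovDual j.1).domRestrict (M.annihilator S))
    (fun j h => j.2 (M.mem_saturation_iff.2 fun ξ hξ => LinearMap.congr_fun h ⟨ξ, hξ⟩))
    𝒰 (a := fun k j => normAtPlace j.1 (u k)) (fun k j => normAtPlace_nonneg _ _)
    (fun j => hua j) (fun k => by
      have := hunot k
      rw [mem_placeSubspace_iff] at this
      push Not at this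
      obtain ⟨w, hw, h⟩ := this
      exact ⟨⟨w, hw⟩, h⟩)
  -- Both `lam` and `t` are fixed before `δ`; only the approximating elements `n k` and the limit
  -- depend on it.
  refine ⟨lam, hlam, ⟨j₀, hj₀⟩, t, ht, fun δ hδ => ?_⟩
  have := M.finiteIndex_stabilizer ht
  obtain ⟨C, hC⟩ := M.exists_near_lyapunov (H ⊓ M.stabilizer t) (M.annihilator S) hδ
  choose n hn hang hsmall hnear using fun k => hC (τ k • η : M.annihilator S) (Subtype.prop _)
  have hslice : ∀ k, n k ∈ M.slice H S δ := fun k =>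
    ⟨(hn k).1, fun w hw => hsmall k w (M.mem_saturation_iff.1 (M.subset_saturation S hw)), hang k⟩
  set y : ℕ → mixedSpace K := fun k => mixedEmbedding K (M.unit (n k)) * (v + u k) with hy
  have hmem : ∀ k, t + M.proj (y k) ∈ M.orbitSum H S x (ε₀ + δ) := by
    intro k
    have h₁ : zs k = t + M.proj (v + u k) := by
      rw [map_add, hpu]
      abel
    have h₂ := M.act_mem_orbitSum (hslice k) (hzs k)
    rwa [h₁, M.act_add_proj_of_mem_stabilizer (hn k).2] at h₂
  have hynorm : ∀ w k, normAtPlace w (y k) =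
      Real.exp (M.lyapunov w (n k)) * normAtPlace w (v + u k) := by
    intro w k
    rw [hy, map_mul, normAtPlace_unit]
  have hexp : ∀ (j : {w // w ∉ M.saturation S}) k,
      Real.exp (-C) * (normAtPlace j.1 (u k) * Real.exp (τ k *
        (M.lyapunovDual j.1).domRestrict (M.annihilator S) η)) ≤ normAtPlace j.1 (y k) ∧
      normAtPlace j.1 (y k) ≤ Real.exp C * (normAtPlace j.1 (u k) * Real.exp (τ k *
        (M.lyapunovDual j.1).domRestrict (M.annihilator S) η)) := by
    intro j k
    have h₁ := abs_le.1 (hnear k j.1)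
    rw [hynorm, normAtPlace_add_of_eq_zero (hv j.1 j.2)]
    have h₂ : τ k * (M.lyapunovDual j.1).domRestrict (M.annihilator S) η =
        M.lyapunovDual j.1 ((τ k • η : M.annihilator S) : Fin r → ℝ) := by simp
    rw [h₂, mul_left_comm, ← Real.exp_add, mul_left_comm, ← Real.exp_add, mul_comm (Real.exp _)]
    have := normAtPlace_nonneg j.1 (u k)
    constructor <;> gcongr <;> linarith [h₁.1, h₁.2]
  obtain ⟨B, hB⟩ : ∃ B, ∀ w, normAtPlace w v ≤ B := by
    obtain ⟨w, hw⟩ := Finite.exists_max fun w => normAtPlace w v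
    exact ⟨_, hw⟩
  obtain ⟨v₁, hv₁⟩ := exists_tendsto_of_normAtPlace_le 𝒰 (f := y)
    (max (Real.exp δ * (B + 1)) (Real.exp C)) (by
      intro w
      by_cases hw : w ∈ M.saturation S
      · filter_upwards [(hua w).eventually_lt_const one_pos] with k hk
        refine le_max_of_le_left ?_
        rw [hynorm]
        have h₁ := (abs_lt.1 (hsmall k w (M.mem_saturation_iff.1 hw))).2
        have h₂ := (normAtPlace_add_le w v (u k)).trans (add_le_add (hB w) hk.le)
        have := normAtPlace_nonneg w (v + u k)
        gcongr
      · filter_upwards [hτ] with k hk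
        refine le_max_of_le_right ((hexp ⟨w, hw⟩ k).2.trans ?_)
        exact mul_le_of_le_one_right (Real.exp_nonneg _) (hk.1 ⟨w, hw⟩))
  have hlimnorm : ∀ w, Tendsto (fun k => normAtPlace w (y k)) 𝒰 (𝓝 (normAtPlace w v₁)) :=
    fun w => ((continuous_normAtPlace w).tendsto v₁).comp hv₁
  have hzero : ∀ w, w ∉ M.saturation S → w ∉ M.coarseIndex S lam → normAtPlace w v₁ = 0 := by
    intro w hw hw'
    refine tendsto_nhds_unique (hlimnorm w) (squeeze_zero (fun k => normAtPlace_nonneg _ _)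
      (fun k => (hexp ⟨w, hw⟩ k).2) ?_)
    simpa using (hτ₀ ⟨w, hw⟩ hw').const_mul (Real.exp C)
  refine ⟨v₁, ?_, ?_, ?_⟩
  · rw [mem_placeSubspace_iff]
    intro w hw
    rw [Set.mem_union, not_or] at hw
    exact hzero w hw.1 hw.2
  -- At each relevant `k` some amplified coordinate equals `1`, so `y k` has size at least `exp
  -- (-C)` there; not all these coordinates can tend to `0`.
  · by_contra! h
    have h₁ : ∀ j : {w // w ∉ M.saturation S}, ∀ᶠ k in 𝒰,
        normAtPlace j.1 (y k) < Real.exp (-C) := by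
      intro j
      refine (hlimnorm j).eventually_lt_const ?_
      have : normAtPlace j.1 v₁ = 0 := by
        by_cases hj : j.1 ∈ M.coarseIndex S lam
        · exact h j hj
        · exact hzero j j.2 hj
      rw [this]
      exact Real.exp_pos _
    obtain ⟨k, hk₁, hk₂⟩ := ((eventually_all.2 h₁).and hτ).exists
    obtain ⟨j, hj⟩ := hk₂.2
    have h₂ := (hexp j k).1
    rw [hj, mul_one] at h₂
    exact (hk₁ j).not_ge h₂
  · refine (M.isClosed_orbitSum H S x _).mem_of_tendsto
      (((M.continuous_proj.tendsto v₁).comp hv₁).const_add t) (.of_forall hmem)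

/-- A closed subset of `X` containing a half-line contains a parallel line. -/
theorem exists_line_of_halfLine {A : Set M.X} (hA : IsClosed A) {d : mixedSpace K} {y : M.X}
    (h : ∀ τ : ℝ, 0 ≤ τ → y + M.proj (τ • d) ∈ A) :
    ∃ y' : M.X, ∀ τ : ℝ, y' + M.proj (τ • d) ∈ A := by
  have := M.cocompact
  -- Slide the base point out along the half-line: seen from `y + k d`, every fixed `τ` is
  -- eventually admissible.
  obtain ⟨y', -, hy'⟩ := (isCompact_univ (X := M.X)).exists_tendsto_ultrafilter (hyperfilter ℕ)
    (f := fun k : ℕ => y + M.proj ((k : ℝ) • d)) (.of_forall fun _ => Set.mem_univ _)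
  refine ⟨y', fun τ => hA.mem_of_tendsto (hy'.add_const (M.proj (τ • d))) ?_⟩
  have h₁ : ∀ᶠ k : ℕ in hyperfilter ℕ, -τ ≤ k :=
    (tendsto_natCast_atTop_atTop.eventually_ge_atTop (-τ)).filter_mono Nat.hyperfilter_le_atTop
  filter_upwards [h₁] with k hk
  rw [add_assoc, ← map_add, ← add_smul]
  exact h _ (by linarith)

/-! ### Shearing by almost trivial elements -/

/-- There are elements of `H` that are nontrivial but act almost trivially on
`V_{⟨S⟩} ⊕ V_{[lam]}`. The smallness is measured by the sequence `ρ`. -/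
theorem exists_almost_trivial_seq {S : Set (InfinitePlace K)} (H : AddSubgroup (Fin r → ℤ))
    [H.FiniteIndex] (hS : Module.finrank ℝ (M.lyapunovSpan S) + 2 ≤ r)
    {lam : Module.Dual ℝ (M.annihilator S)} (hne : (M.coarseIndex S lam).Nonempty) :
    ∃ (n : ℕ → Fin r → ℤ) (ρ : ℕ → ℝ), Tendsto ρ atTop (𝓝 0) ∧ ∀ k, n k ∈ H ∧ n k ≠ 0 ∧
      0 < ρ k ∧ (∀ w, ‖M.angle w (n k)‖ ≤ ρ k) ∧
      ∀ w ∈ M.saturation S ∪ M.coarseIndex S lam, |M.lyapunov w (n k)| ≤ ρ k ∧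
        normAtPlace w (mixedEmbedding K (M.unit (n k)) - 1) ≤ ρ k := by
  classical
  set J := M.saturation S ∪ M.coarseIndex S lam
  -- Every `λ_w` with `w ∈ J` vanishes on the kernel of `lam` in `P_S`; this kernel is nonzero
  -- because `dim P_S ≥ 2`.
  set P' : Submodule ℝ (Fin r → ℝ) := (LinearMap.ker lam).map (M.annihilator S).subtype with hP'
  have hP'₀ : P' ≠ ⊥ := by
    intro h
    have h₀ : LinearMap.ker lam = ⊥ := Submodule.map_injective_of_injective
      (Submodule.injective_subtype _) (h.trans (Submodule.map_bot _).symm)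
    have h₁ := LinearMap.finrank_le_finrank_of_injective (LinearMap.ker_eq_bot.1 h₀)
    have h₂ := M.two_le_finrank_annihilator hS
    rw [Module.finrank_self] at h₁
    omega
  have hvanish : ∀ w ∈ J, ∀ ξ ∈ P', M.lyapunovDual w ξ = 0 := by
    rintro w (hw | ⟨c, -, hc⟩) _ ⟨ξ, hξ, rfl⟩
    · exact M.mem_saturation_iff.1 hw _ ξ.2
    · have h₁ : lam ξ = 0 := hξ
      simpa [h₁] using LinearMap.congr_fun hc ξ
  choose n hn hn₀ hang hsmall using fun k : ℕ =>
    M.exists_ne_zero_small H hP'₀ (Nat.one_div_pos_of_nat (α := ℝ) (n := k))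
  have hang₀ : ∀ w, Tendsto (fun k => ‖M.angle w (n k)‖) atTop (𝓝 0) := fun w =>
    squeeze_zero (fun _ => norm_nonneg _) (fun k => (hang k w).le)
      tendsto_one_div_add_atTop_nhds_zero_nat
  have hlya₀ : ∀ w ∈ J, Tendsto (fun k => |M.lyapunov w (n k)|) atTop (𝓝 0) := fun w hw =>
    squeeze_zero (fun _ => abs_nonneg _) (fun k => (hsmall k w (hvanish w hw)).le)
      tendsto_one_div_add_atTop_nhds_zero_nat
  have hnorm₀ : ∀ w ∈ J, Tendsto
      (fun k => normAtPlace w (mixedEmbedding K (M.unit (n k)) - 1)) atTop (𝓝 0) := by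
    intro w hw
    refine squeeze_zero (fun _ => normAtPlace_nonneg _ _)
      (fun k => M.normAtPlace_unit_sub_one_le w (n k)) ?_
    have h₁ : Tendsto (fun k => M.lyapunov w (n k)) atTop (𝓝 0) :=
      (tendsto_zero_iff_abs_tendsto_zero _).2 (hlya₀ w hw)
    have h₂ := (((Real.continuous_exp.tendsto 0).comp h₁).sub_const 1).abs
    simpa using h₂.add (hang₀ w)
  set R : ℕ → InfinitePlace K → ℝ := fun k w => ‖M.angle w (n k)‖ +
    if w ∈ J then |M.lyapunov w (n k)| +
      normAtPlace w (mixedEmbedding K (M.unit (n k)) - 1) else 0 with hR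
  have hR₀ : ∀ k w, 0 ≤ R k w := by
    intro k w
    have := normAtPlace_nonneg w (mixedEmbedding K (M.unit (n k)) - 1)
    simp only [hR]
    split_ifs <;> positivity
  have hRle : ∀ k w, R k w ≤ ∑ w, R k w := fun k w =>
    Finset.single_le_sum (fun w _ => hR₀ k w) (Finset.mem_univ w)
  refine ⟨n, fun k => ∑ w, R k w, ?_, fun k => ⟨hn k, hn₀ k, ?_, fun w => ?_, fun w hw => ?_⟩⟩
  · rw [← Finset.sum_const_zero (s := (Finset.univ : Finset (InfinitePlace K)))]
    refine tendsto_finsetSum _ fun w _ => ?_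
    by_cases hw : w ∈ J
    · simpa [hR, hw] using (hang₀ w).add ((hlya₀ w hw).add (hnorm₀ w hw))
    · simpa [hR, hw] using hang₀ w
  · obtain ⟨i, hi⟩ := hne
    refine lt_of_lt_of_le ?_ (hRle k i)
    have h₁ := M.normAtPlace_unit_sub_one_pos i (hn₀ k)
    simp only [hR]
    rw [if_pos (show i ∈ J from Or.inr hi)]
    positivity
  · refine le_trans ?_ (hRle k w)
    have h₁ := normAtPlace_nonneg w (mixedEmbedding K (M.unit (n k)) - 1)
    simp only [hR, le_add_iff_nonneg_right]
    split_ifs <;> positivity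
  · have h₁ := normAtPlace_nonneg w (mixedEmbedding K (M.unit (n k)) - 1)
    have h₂ := hRle k w
    simp only [hR] at h₂
    rw [if_pos hw] at h₂
    have h₃ := abs_nonneg (M.lyapunov w (n k))
    have h₄ := norm_nonneg (M.angle w (n k))
    constructor <;> linarith

theorem nsmul_mem_slice {H : AddSubgroup (Fin r → ℤ)} {S : Set (InfinitePlace K)} {δ ρ : ℝ}
    {n : Fin r → ℤ} (hn : n ∈ H) (hS : ∀ w ∈ S, |M.lyapunov w n| ≤ ρ)
    (hang : ∀ w, ‖M.angle w n‖ ≤ ρ) {q : ℕ} (hq : q * ρ < δ) : q • n ∈ M.slice H S δ := by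
  refine ⟨H.nsmul_mem hn q, fun w hw => ?_, fun w => ?_⟩
  · rw [map_nsmul, nsmul_eq_mul, abs_mul, Nat.abs_cast]
    exact (mul_le_mul_of_nonneg_left (hS w hw) q.cast_nonneg).trans_lt hq
  · rw [← show M.angleHom w _ = M.angle w _ from rfl, map_nsmul]
    exact (norm_nsmul_le (n := q) (a := M.angle w n)).trans_lt
      ((mul_le_mul_of_nonneg_left (hang w) q.cast_nonneg).trans_lt hq)

/-- Moving a point with a nontrivial component in a coarse Lyapunov subspace `V_{[lam]}` by
almost trivial elements, after amplifying this component, produces a half-line in a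
direction of `V_{[lam]}`. -/
theorem exists_halfLine {S : Set (InfinitePlace K)} {H : AddSubgroup (Fin r → ℤ)}
    [H.FiniteIndex] (hS : Module.finrank ℝ (M.lyapunovSpan S) + 2 ≤ r)
    {l : ℕ} {x : Fin l → M.X} {lam : Module.Dual ℝ (M.annihilator S)} (hlam : lam ≠ 0)
    {t : M.X} (ht : IsOfFinAddOrder t) {v : mixedSpace K}
    (hv : v ∈ placeSubspace (M.saturation S ∪ M.coarseIndex S lam)) {i : InfinitePlace K}
    (hi : i ∈ M.coarseIndex S lam) (hvi : normAtPlace i v ≠ 0) {ε δ : ℝ} (hδ : 0 < δ)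
    (hmem : t + M.proj v ∈ M.orbitSum H S x ε) :
    ∃ d ∈ placeSubspace (M.coarseIndex S lam), d ≠ 0 ∧
      ∃ y : M.X, ∀ τ : ℝ, 0 ≤ τ → y + M.proj (τ • d) ∈ M.orbitSum H S x (ε + δ) := by
  classical
  have := M.cocompact
  have := M.finiteIndex_stabilizer ht
  rw [mem_placeSubspace_iff] at hv
  set 𝒰 : Ultrafilter ℕ := hyperfilter ℕ
  set J := M.saturation S ∪ M.coarseIndex S lam
  obtain ⟨n, ρ, hρ, hn⟩ := M.exists_almost_trivial_seq (H ⊓ M.stabilizer t) hS ⟨i, hi⟩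
  choose hnH hn₀ hρ₀ hang hsmall using hn
  replace hρ : Tendsto ρ 𝒰 (𝓝 0) := hρ.mono_left Nat.hyperfilter_le_atTop
  have hsq : Tendsto (fun k => √(ρ k)) 𝒰 (𝓝 0) := by
    simpa [Function.comp_def] using (Real.continuous_sqrt.tendsto 0).comp hρ
  have hsq₀ : ∀ k, 0 < √(ρ k) := fun k => Real.sqrt_pos.2 (hρ₀ k)
  have hsqsq : ∀ k, √(ρ k) * √(ρ k) = ρ k := fun k => Real.mul_self_sqrt (hρ₀ k).le
  set h : ℕ → mixedSpace K := fun k => mixedEmbedding K (M.unit (n k)) - 1 with hh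
  have hh₀ : ∀ k w, 0 ≤ normAtPlace w (h k) := fun k w => normAtPlace_nonneg _ _
  have hv₀ : ∀ w, 0 ≤ normAtPlace w v := fun w => normAtPlace_nonneg _ _
  obtain ⟨B, hB⟩ : ∃ B, ∀ w, normAtPlace w v ≤ B := by
    obtain ⟨w, hw⟩ := Finite.exists_max fun w => normAtPlace w v
    exact ⟨_, hw⟩
  have hB₀ : 0 ≤ B := (hv₀ i).trans (hB i)
  obtain ⟨η, hη⟩ : ∃ η, lam η = 1 := by
    by_contra! h'
    obtain ⟨ξ, hξ⟩ : ∃ ξ, lam ξ ≠ 0 := by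
      by_contra! h₁
      exact hlam (LinearMap.ext h₁)
    exact h' ((lam ξ)⁻¹ • ξ) (by simp [hξ])
  have hηi : 0 < M.lyapunovDual i η := by
    obtain ⟨c, hc, hci⟩ := hi
    have := LinearMap.congr_fun hci η
    simp only [LinearMap.domRestrict_apply, LinearMap.smul_apply, hη, smul_eq_mul, mul_one] at this
    rwa [this]
  set I' : Finset (InfinitePlace K) := Finset.univ.filter (· ∈ M.coarseIndex S lam) with hI'
  have hI'_mem : ∀ {w}, w ∈ I' ↔ w ∈ M.coarseIndex S lam := by simp [hI']
  -- Up to a factor `exp (±C)`, `g k s` measures the `V_{[lam]}` part of the step `h k` applied to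
  -- `v` pushed to time `s` along `η`. The intermediate value theorem tunes it to `√(ρ k)`, well
  -- above the `O(ρ k)` part in `V_⟨S⟩`.
  set g : ℕ → ℝ → ℝ := fun k s => ∑ w ∈ I',
    normAtPlace w (h k) * normAtPlace w v * Real.exp (s * M.lyapunovDual w η) with hg
  have hT : ∀ k, ∃ s, √(ρ k) * (I'.card * B) ≤ 1 → g k s = √(ρ k) := by
    intro k
    by_cases hk : √(ρ k) * (I'.card * B) ≤ 1
    swap
    · exact ⟨0, fun h' => absurd h' hk⟩
    have hcont : Continuous (g k) := by fun_prop
    have h₀ : g k 0 ≤ √(ρ k) := by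
      have h₁ : g k 0 ≤ ∑ w ∈ I', ρ k * B := by
        refine Finset.sum_le_sum fun w hw => ?_
        rw [zero_mul, Real.exp_zero, mul_one]
        exact mul_le_mul (hsmall k w (Or.inr (hI'_mem.1 hw))).2 (hB w) (hv₀ w) (hρ₀ k).le
      rw [Finset.sum_const, nsmul_eq_mul] at h₁
      have h₂ := mul_le_mul_of_nonneg_left hk (hsq₀ k).le
      rw [← mul_assoc, hsqsq] at h₂
      linarith
    have hb : 0 < normAtPlace i (h k) * normAtPlace i v :=
      mul_pos (M.normAtPlace_unit_sub_one_pos i (hn₀ k)) ((hv₀ i).lt_of_ne' hvi)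
    -- By `1 + x ≤ exp x`, the `i`-th term alone exceeds `√(ρ k)` at this time.
    have h₁ : √(ρ k) ≤
        g k (√(ρ k) / (normAtPlace i (h k) * normAtPlace i v * M.lyapunovDual i η)) := by
      refine le_trans ?_ (Finset.single_le_sum (f := fun w => normAtPlace w (h k) *
        normAtPlace w v * Real.exp (_ * M.lyapunovDual w η)) (fun w _ => by
          have := hh₀ k w
          have := hv₀ w
          positivity) (hI'_mem.2 hi))
      refine le_trans ?_ (mul_le_mul_of_nonneg_left (Real.add_one_le_exp _) hb.le)
      have h₃ : normAtPlace i (h k) * normAtPlace i v * (√(ρ k) / (normAtPlace i (h k) *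
          normAtPlace i v * M.lyapunovDual i η) * M.lyapunovDual i η + 1) =
          √(ρ k) + normAtPlace i (h k) * normAtPlace i v := by
        have h₄ := hηi.ne'
        have h₅ := hb.ne'
        generalize normAtPlace i (h k) * normAtPlace i v = b at h₅ ⊢
        field_simp
      rw [h₃]
      linarith
    obtain ⟨s, hs⟩ := mem_range_of_exists_le_of_exists_ge hcont ⟨0, h₀⟩ ⟨_, h₁⟩
    exact ⟨s, fun _ => hs⟩
  choose T hT using hT
  have hgT : ∀ᶠ k in 𝒰, g k (T k) = √(ρ k) := by
    have h₁ : Tendsto (fun k => √(ρ k) * (I'.card * B)) 𝒰 (𝓝 0) := by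
      simpa using hsq.mul_const (I'.card * B)
    filter_upwards [h₁.eventually_lt_const one_pos] with k hk
    exact hT k hk.le
  obtain ⟨C, hC⟩ := M.exists_near_lyapunov (H ⊓ M.stabilizer t) (M.annihilator S) (half_pos hδ)
  choose m hmH hmang hmsmall hmnear using fun k => hC (T k • η : M.annihilator S) (Subtype.prop _)
  have hmslice : ∀ k, m k ∈ M.slice H S (δ / 2) := fun k =>
    ⟨(hmH k).1, fun w hw => hmsmall k w (M.mem_saturation_iff.1 (M.subset_saturation S hw)),
      hmang k⟩
  set p : ℕ → mixedSpace K := fun k => mixedEmbedding K (M.unit (m k)) * v with hp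
  -- The vectors `p k` need not be bounded; only their classes in `X` are made to converge.
  obtain ⟨y, -, hy⟩ := (isCompact_univ (X := M.X)).exists_tendsto_ultrafilter 𝒰
    (f := fun k => t + M.proj (p k)) (.of_forall fun _ => Set.mem_univ _)
  have hpJ : ∀ k w, w ∉ J → normAtPlace w (p k) = 0 := by
    intro k w hw
    rw [hp, map_mul, hv w hw, mul_zero]
  have hexp : ∀ k w,
      Real.exp (-C) * (normAtPlace w v * Real.exp (T k * M.lyapunovDual w η)) ≤
        normAtPlace w (p k) ∧
      normAtPlace w (p k) ≤
        Real.exp C * (normAtPlace w v * Real.exp (T k * M.lyapunovDual w η)) := by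
    intro k w
    have h₁ := abs_le.1 (hmnear k w)
    rw [Submodule.coe_smul, map_smul, smul_eq_mul] at h₁
    rw [hp, map_mul, normAtPlace_unit, mul_left_comm, ← Real.exp_add, mul_left_comm,
      ← Real.exp_add, mul_comm (Real.exp _)]
    have := hv₀ w
    constructor <;> gcongr <;> linarith [h₁.1, h₁.2]
  -- The normalized step: its `V_⟨S⟩` part is `O(√(ρ k))`, and its `V_{[lam]}` part is bounded and
  -- stays away from `0`.
  set d : ℕ → mixedSpace K := fun k => (√(ρ k))⁻¹ • (h k * p k) with hd
  have hdnorm : ∀ k w, normAtPlace w (d k) =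
      (√(ρ k))⁻¹ * (normAtPlace w (h k) * normAtPlace w (p k)) := by
    intro k w
    rw [hd, normAtPlace_smul, abs_of_pos (inv_pos.2 (hsq₀ k)), map_mul]
  have hdsat : ∀ k, ∀ w ∈ M.saturation S,
      normAtPlace w (d k) ≤ √(ρ k) * (Real.exp (δ / 2) * B) := by
    intro k w hw
    have h₁ : normAtPlace w (p k) ≤ Real.exp (δ / 2) * B := by
      rw [hp, map_mul, normAtPlace_unit]
      have := (abs_lt.1 (hmsmall k w (M.mem_saturation_iff.1 hw))).2
      have := hv₀ w
      gcongr
      exact hB w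
    rw [hdnorm, inv_mul_le_iff₀ (hsq₀ k), ← mul_assoc, hsqsq]
    exact mul_le_mul (hsmall k w (Or.inl hw)).2 h₁ (normAtPlace_nonneg _ _) (hρ₀ k).le
  have hdcoarse : ∀ᶠ k in 𝒰, ∀ w ∈ M.coarseIndex S lam, normAtPlace w (d k) ≤ Real.exp C := by
    filter_upwards [hgT] with k hk w hw
    rw [hdnorm, inv_mul_le_iff₀ (hsq₀ k), ← hk, mul_comm (g k _)]
    refine (mul_le_mul_of_nonneg_left (hexp k w).2 (hh₀ k w)).trans ?_
    rw [mul_left_comm, ← mul_assoc (normAtPlace w (h k))]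
    refine mul_le_mul_of_nonneg_left ?_ (Real.exp_nonneg _)
    exact Finset.single_le_sum (f := fun w => normAtPlace w (h k) * normAtPlace w v *
      Real.exp (T k * M.lyapunovDual w η)) (fun w _ => by
        have := hh₀ k w
        have := hv₀ w
        positivity) (hI'_mem.2 hw)
  set D := max (Real.exp (δ / 2) * B) (Real.exp C) with hD
  have hD₀ : 0 < D := (Real.exp_pos C).trans_le (le_max_right _ _)
  have hdbound : ∀ᶠ k in 𝒰, ∀ w, normAtPlace w (d k) ≤ D := by
    filter_upwards [hdcoarse, hsq.eventually_lt_const one_pos] with k hk hk₁ w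
    by_cases hw : w ∈ J
    · rcases hw with hw | hw
      · refine ((hdsat k w hw).trans ?_).trans (le_max_left _ _)
        exact mul_le_of_le_one_left (by positivity) hk₁.le
      · exact (hk w hw).trans (le_max_right _ _)
    · rw [hdnorm, hpJ k w hw, mul_zero, mul_zero]
      exact hD₀.le
  obtain ⟨d₁, hd₁⟩ := exists_tendsto_of_normAtPlace_le 𝒰 (f := d) D fun w =>
    hdbound.mono fun k hk => hk w
  have hlimnorm : ∀ w, Tendsto (fun k => normAtPlace w (d k)) 𝒰 (𝓝 (normAtPlace w d₁)) :=
    fun w => ((continuous_normAtPlace w).tendsto d₁).comp hd₁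
  refine ⟨d₁, ?_, ?_, y, fun τ hτ => ?_⟩
  · rw [mem_placeSubspace_iff]
    intro w hw
    refine tendsto_nhds_unique (hlimnorm w) ?_
    by_cases hws : w ∈ M.saturation S
    · refine squeeze_zero (fun k => normAtPlace_nonneg _ _) (fun k => hdsat k w hws) ?_
      simpa using hsq.mul_const (Real.exp (δ / 2) * B)
    · refine tendsto_const_nhds.congr fun k => ?_
      rw [hdnorm, hpJ k w (by rintro (h' | h') <;> contradiction), mul_zero, mul_zero]
  · rintro rfl
    have h₁ : Tendsto (fun k => ∑ w ∈ I', normAtPlace w (d k)) 𝒰 (𝓝 0) := by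
      simpa using tendsto_finsetSum I' fun w _ => hlimnorm w
    obtain ⟨k, hk, hk₁⟩ := ((h₁.eventually_lt_const (Real.exp_pos (-C))).and hgT).exists
    refine hk.not_ge ?_
    have h₂ : Real.exp (-C) = (√(ρ k))⁻¹ * (Real.exp (-C) * g k (T k)) := by
      rw [hk₁]
      have := (hsq₀ k).ne'
      field_simp
    rw [h₂, hg, Finset.mul_sum, Finset.mul_sum]
    refine Finset.sum_le_sum fun w _ => ?_
    rw [hdnorm]
    refine mul_le_mul_of_nonneg_left ?_ (inv_nonneg.2 (hsq₀ k).le)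
    refine le_trans (le_of_eq ?_) (mul_le_mul_of_nonneg_left (hexp k w).1 (hh₀ k w))
    ring
  -- This many steps of length about `√(ρ k)` travel to time `τ`, while `q k * ρ k ≤ τ √(ρ k)` still
  -- tends to `0`, which keeps `q k • n k` in a thin slice.
  · set q : ℕ → ℕ := fun k => ⌊τ / √(ρ k)⌋₊ with hq
    have hqle : ∀ k, q k * √(ρ k) ≤ τ := fun k =>
      (le_div_iff₀ (hsq₀ k)).1 (Nat.floor_le (div_nonneg hτ (hsq₀ k).le))
    have hqlim : Tendsto (fun k => q k * √(ρ k)) 𝒰 (𝓝 τ) := by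
      refine tendsto_of_tendsto_of_tendsto_of_le_of_le (g := fun k => τ - √(ρ k))
        (by simpa using hsq.const_sub τ) tendsto_const_nhds (fun k => ?_) hqle
      have := (Nat.lt_floor_add_one (τ / √(ρ k))).le
      rw [div_le_iff₀ (hsq₀ k)] at this
      simp only [hq]
      linarith
    have hqρ : ∀ k, q k * ρ k ≤ τ * √(ρ k) := fun k => by
      have h₁ := mul_le_mul_of_nonneg_right (hqle k) (hsq₀ k).le
      rwa [mul_assoc, hsqsq] at h₁
    have hτsq : Tendsto (fun k => τ * √(ρ k)) 𝒰 (𝓝 0) := by simpa using hsq.const_mul τ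
    -- Since `p k` may be large, the quadratic error is split as `(q |h|) (q |h| |p|)`: the first
    -- factor tends to `0` and the second, the distance travelled, is at most `τ D`.
    have herr : Tendsto (fun k => ((1 + h k) ^ q k - 1 - q k * h k) * p k) 𝒰 (𝓝 0) := by
      rw [tendsto_mixedSpace_iff]
      intro w
      simp only [sub_zero, map_mul]
      by_cases hw : w ∈ J
      swap
      · simp [hpJ _ w hw]
      have hz : Tendsto (fun k => τ * √(ρ k) * (τ * D)) 𝒰 (𝓝 0) := by
        simpa using hτsq.mul_const (τ * D)
      refine squeeze_zero' (.of_forall fun k => mul_nonneg (normAtPlace_nonneg _ _)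
        (normAtPlace_nonneg _ _)) ?_ hz
      filter_upwards [hdbound, hτsq.eventually_lt_const one_pos] with k hk hk₁
      have h₁ : q k * normAtPlace w (h k) ≤ τ * √(ρ k) :=
        (mul_le_mul_of_nonneg_left (hsmall k w hw).2 (q k).cast_nonneg).trans (hqρ k)
      have h₂ : q k * normAtPlace w (h k) * normAtPlace w (p k) ≤ τ * D := by
        have h₃ : normAtPlace w (h k) * normAtPlace w (p k) = √(ρ k) * normAtPlace w (d k) := by
          rw [hdnorm, mul_inv_cancel_left₀ (hsq₀ k).ne']
        rw [mul_assoc, h₃, ← mul_assoc]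
        exact mul_le_mul (hqle k) (hk w) (normAtPlace_nonneg _ _) hτ
      have h₄ := normAtPlace_one_add_pow_sub_linear_le_sq w (h k) (q k) (h₁.trans hk₁.le)
      refine (mul_le_mul_of_nonneg_right h₄ (normAtPlace_nonneg w (p k))).trans ?_
      rw [sq, mul_assoc]
      exact mul_le_mul h₁ h₂ (mul_nonneg (mul_nonneg (q k).cast_nonneg (hh₀ k w))
        (normAtPlace_nonneg _ _)) (mul_nonneg hτ (hsq₀ k).le)
    have hdisp : Tendsto (fun k => ((1 + h k) ^ q k - 1) * p k) 𝒰 (𝓝 (τ • d₁)) := by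
      have h₁ := herr.add (hqlim.smul hd₁)
      rw [zero_add] at h₁
      refine h₁.congr fun k => ?_
      have h₂ : ((q k : ℝ) * √(ρ k)) • d k = (q k : mixedSpace K) * (h k * p k) := by
        rw [hd, smul_smul, mul_assoc, mul_inv_cancel₀ (hsq₀ k).ne', mul_one,
          Nat.cast_smul_eq_nsmul, nsmul_eq_mul]
      rw [h₂]
      ring
    refine (M.isClosed_orbitSum H S x _).mem_of_tendsto
      (hy.add ((M.continuous_proj.tendsto _).comp hdisp)) ?_
    filter_upwards [hτsq.eventually_lt_const (half_pos hδ)] with k hk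
    have h₁ : m k + q k • n k ∈ M.slice H S (δ / 2 + δ / 2) :=
      M.add_mem_slice (hmslice k) (M.nsmul_mem_slice (hnH k).1
        (fun w hw => (hsmall k w (Or.inl (M.subset_saturation S hw))).1) (hang k)
        ((hqρ k).trans_lt hk))
    have h₂ := M.act_mem_orbitSum h₁ hmem
    rw [M.act_add_proj_of_mem_stabilizer ((M.stabilizer t).add_mem (hmH k).2
      ((M.stabilizer t).nsmul_mem (hnH k).2 _)), add_halves, unit_add, unit_nsmul,
      map_mul (mixedEmbedding K), map_pow (mixedEmbedding K)] at h₂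
    have h₃ : mixedEmbedding K (M.unit (n k)) = 1 + h k := by simp [hh]
    rw [Function.comp_apply, add_assoc, ← map_add]
    convert h₂ using 3
    rw [h₃, hp]
    ring

end UnitAction

/-! ### Conclusion -/

theorem proposition3p7 {K : Type*} [Field K] [NumberField K] {r d : ℕ}
    (hd : Module.finrank ℚ K = d)
    (α : Multiplicative (Fin r → ℤ) →* Matrix.GeneralLinearGroup (Fin d) ℤ)
    (hirr : ∃ n, IsIrreducibleToral (α n))
    (M : UnitAction K r)
    (ψ : (Fin d → UnitAddCircle) ≃+ M.X) (hψ : Continuous ψ)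
    (hconj : ∀ (n : Fin r → ℤ) (y : Fin d → UnitAddCircle),
      ψ (toralAut (α (Multiplicative.ofAdd n)) y) = M.act n (ψ y))
    (S : Set (InfinitePlace K))
    (hS : Module.finrank ℝ (M.lyapunovSpan S) + 2 ≤ r)
    (htot : ∀ ε : ℝ, 0 < ε → ∃ n : Fin r → ℤ,
      IsTotallyIrreducibleToral (α (Multiplicative.ofAdd n)) ∧ ∀ w ∈ S, |M.lyapunov w n| < ε)
    (H : AddSubgroup (Fin r → ℤ)) (hH : H.FiniteIndex)
    {l : ℕ} (x : Fin l → M.X)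
    (ε₀ : ℝ) (hε₀ : 0 < ε₀)
    (hpat : M.ContainsPattern (placeSubspace (M.saturation S)) (M.orbitSum H S x ε₀)) :
    ∃ lam : Module.Dual ℝ (M.annihilator S), lam ≠ 0 ∧ (M.coarseIndex S lam).Nonempty ∧
      ∀ ε : ℝ, ε₀ < ε →
        ∃ L : Submodule ℝ (mixedSpace K), Module.finrank ℝ L = 1 ∧
          L ≤ placeSubspace (M.coarseIndex S lam) ∧
          ∃ y : M.X, ∀ v ∈ L, y + M.proj v ∈ M.orbitSum H S x ε := by
  obtain ⟨lam, hlam, hne, t, ht, hpt⟩ := M.exists_expanded_point hpat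
  refine ⟨lam, hlam, hne, fun ε hε => ?_⟩
  -- Half of the gap is spent on the expansion and half on the shearing.
  have hδ : 0 < (ε - ε₀) / 2 := by linarith
  obtain ⟨v, hv, ⟨i, hi, hvi⟩, hmem⟩ := hpt _ hδ
  obtain ⟨e, he, he₀, y, hy⟩ := M.exists_halfLine hS hlam ht hv hi hvi hδ hmem
  obtain ⟨y', hy'⟩ := M.exists_line_of_halfLine (M.isClosed_orbitSum H S x _) hy
  refine ⟨ℝ ∙ e, finrank_span_singleton he₀, ?_, y', fun u hu => ?_⟩
  · rwa [Submodule.span_singleton_le_iff_mem]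
  · obtain ⟨τ, rfl⟩ := Submodule.mem_span_singleton.1 hu
    have := hy' τ
    rwa [show ε₀ + (ε - ε₀) / 2 + (ε - ε₀) / 2 = ε by ring] at this
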